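/- Let $(M,d)$ be a compact connected metric space with more than one point. A continuous map $T:M\to M$ is called Ruelle-expanding if (1) there is $c>0$ such that $x\ne y$ and $T(x)=T(y)$ imply $d(x,y)>c$; and (2) there are $r>0$ and $0<\rho<1$ such that for every $x\in M$ and every $a\in T^{-1}(\{x\})$ there is a map $\varphi:B_r(x)\to M$ with $\varphi(x)=a$, $T(\varphi(z))=z$ and $d(\varphi(z),\varphi(w))\le\rho\, d(z,w)$ for all $z,w\in B_r(x)$. Let $p\ge 1$, let $g_1,\dots,g_p:M\to M$ be Ruelle-expanding, and let $S$ be the action on $M$ of the semigroup they generate. For a word $w=(i_1,\dots,i_n)\in\{1,\dots,p\}^n$ write $|w|=n$, $g_w=g_{i_n}\circ\cdots\circ g_{i_1}$ and $g_{w,j}=g_{i_j}\circ\cdots\circ g_{i_1}$ for $0\le j\le n$ (with $g_{w,0}=\mathrm{id}$). Let $s(w,\varepsilon)$ be the maximal cardinality of a set $K\subset M$ such that $\max_{0\le j\le n}d(g_{w,j}(x),g_{w,j}(y))>\varepsilon$ for all distinct $x,y\in K$, and let the topological entropy of the action be $$h_{\mathrm{top}}(S)=\lim_{\varepsilon\to0^+}\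 \limsup_{n\to\infty}\frac1n\log\Big(\frac1{p^n}\sum_{|w|=n}s(w,\varepsilon)\Big).$$ Let $\mathrm{Fix}(g_w)$ be the set of fixed points of $g_w$. For $n\ge1$ let $\mathbf L_{n,0}$ be the bounded linear operator of $C^0(M)$ (with the uniform norm) given by $$\mathbf L_{n,0}(\psi)(x)=\frac1{p^n}\sum_{|w|=n}\ \sum_{g_w(y)=x}\psi(y),$$ and let the spectral radius $\mathrm{sp}\big((\mathbf L_{n,0})_n\big)$ of this sequence be defined by $\log \mathrm{sp}\big((\mathbf L_{n,0})_n\big)=\limsup_{n\to\infty}\frac1n\log\|\mathbf L_{n,0}(\mathbf 1)\|_{C^0}$. Then $h_{\mathrm{top}}(S)$ is finite, the limit below exists, and $$0<h_{\mathrm{top}}(S)=\lim_{n\to\infty}\frac1n\log\Big(\frac1{p^n}\sum_{|w|=n}\#\,\mathrm{Fix}(g_w)\Big)=\log \mathrm{sp}\big((\mathbf L_{n,0})_n\big).$$ -/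

import Mathlib

open Filter Topology Set
open scoped ENNReal

namespace SemigroupAction

/-! ### Ruelle-expanding maps -/

/-- A continuous self-map `T` of a metric space is *Ruelle-expanding* if distinct points with the
same image are uniformly separated, and if all inverse branches of `T` are defined, and uniformly
contracting, on open balls of a uniform radius. -/
structure IsRuelleExpanding {M : Type*} [MetricSpace M] (T : M → M) : Prop where
  continuous : Continuous T
  separated : ∃ c : ℝ, 0 < c ∧ ∀ x y : M, x ≠ y → T x = T y → c < dist x y
  inverse_branch : ∃ r ρ : ℝ, 0 < r ∧ 0 < ρ ∧ ρ < 1 ∧ ∀ x a : M, T a = x →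
    ∃ φ : M → M, φ x = a ∧ (∀ z ∈ Metric.ball x r, T (φ z) = z) ∧
      ∀ z ∈ Metric.ball x r, ∀ w ∈ Metric.ball x r, dist (φ z) (φ w) ≤ ρ * dist z w

theorem IsRuelleExpanding.isLocalHomeomorph {M : Type*} [MetricSpace M] {T : M → M}
    (hT : IsRuelleExpanding T) : IsLocalHomeomorph T := by
  obtain ⟨c, hc, hsep⟩ := hT.separated
  obtain ⟨r, ρ, hr, hρ, hρ1, hbr⟩ := hT.inverse_branch
  have hopen : IsOpenMap T := by
    rw [isOpenMap_iff_nhds_le]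
    intro a s hs
    obtain ⟨φ, hφa, hφ, hφd⟩ := hbr (T a) a rfl
    obtain ⟨e, he, hes⟩ := Metric.mem_nhds_iff.1 (Filter.mem_map.1 hs)
    refine Metric.mem_nhds_iff.2 ⟨min r e, lt_min hr he, fun z hz => ?_⟩
    have hz1 : z ∈ Metric.ball (T a) r := Metric.ball_subset_ball (min_le_left _ _) hz
    have hz2 : dist z (T a) < e := lt_of_lt_of_le (Metric.mem_ball.1 hz) (min_le_right _ _)
    have h1 : φ z ∈ Metric.ball a e := by
      have h2 := hφd z hz1 (T a) (Metric.mem_ball_self hr)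
      rw [hφa] at h2
      have h3 : ρ * dist z (T a) ≤ dist z (T a) :=
        mul_le_of_le_one_left dist_nonneg hρ1.le
      exact Metric.mem_ball.2 (lt_of_le_of_lt (h2.trans h3) hz2)
    have h4 := hes h1
    rw [Set.mem_preimage, hφ z hz1] at h4
    exact h4
  rw [isLocalHomeomorph_iff_isOpenEmbedding_restrict]
  intro a
  refine ⟨Metric.ball a (c / 2), Metric.ball_mem_nhds a (half_pos hc), ?_⟩
  refine IsOpenEmbedding.of_continuous_injective_isOpenMap
    (hT.continuous.comp continuous_subtype_val) ?_
    (hopen.comp Metric.isOpen_ball.isOpenMap_subtype_val)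
  rintro ⟨x, hx⟩ ⟨y, hy⟩ hxy
  by_contra hne
  have hne' : x ≠ y := fun h => hne (Subtype.ext h)
  have h1 := hsep x y hne' hxy
  have h2 := dist_triangle_right x y a
  rw [Metric.mem_ball] at hx hy
  linarith

/-! ### Words in the generators

The generators are a family `g : Fin p → M → M`; the words of length `n` are the functions
`w : Fin n → Fin p`, the letter `w 0` being applied first. -/

/-- The composition of a list of generators, the head of the list being applied first. -/
def compList {M : Type*} {p : ℕ} (g : Fin p → M → M) : List (Fin p) → M → M
  | [] => id
  | i :: l => compList g l ∘ g i

/-- The map `g_{w_j} ∘ ⋯ ∘ g_{w_1}` given by the first `j` letters of the word `w`. -/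
def prefixMap {M : Type*} {p n : ℕ} (g : Fin p → M → M) (w : Fin n → Fin p) (j : ℕ) : M → M :=
  compList g ((List.ofFn w).take j)

/-- The map `g_w = g_{w_n} ∘ ⋯ ∘ g_{w_1}` given by the whole word `w`. -/
def wordMap {M : Type*} {p n : ℕ} (g : Fin p → M → M) (w : Fin n → Fin p) : M → M :=
  compList g (List.ofFn w)

theorem isLocalHomeomorph_compList {M : Type*} [TopologicalSpace M] {p : ℕ} {g : Fin p → M → M}
    (hg : ∀ i, IsLocalHomeomorph (g i)) (l : List (Fin p)) :
    IsLocalHomeomorph (compList g l) := by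
  induction l with
  | nil => exact (Homeomorph.refl M).isLocalHomeomorph
  | cons i l ih => exact ih.comp (hg i)

/-- The average over the `p ^ n` words of length `n` of a quantity in `[0, ∞]`. -/
noncomputable def wordAverage (p n : ℕ) (F : (Fin n → Fin p) → ℝ≥0∞) : ℝ≥0∞ :=
  (∑ w : Fin n → Fin p, F w) / (p : ℝ≥0∞) ^ n

/-! ### Topological entropy of the semigroup action -/

/-- The dynamical distance `d_w(x, y) = max_{0 ≤ j ≤ n} d(g_{w_j} ⋯ g_{w_1} x, g_{w_j} ⋯ g_{w_1} y)`
along a word `w` of length `n`. -/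
noncomputable def dynDist {M : Type*} [MetricSpace M] {p n : ℕ} (g : Fin p → M → M)
    (w : Fin n → Fin p) (x y : M) : ℝ :=
  (Finset.range (n + 1)).sup' Finset.nonempty_range_add_one
    (fun j => dist (prefixMap g w j x) (prefixMap g w j y))

/-- `K` is separated at scale `ε` along the word `w`. -/
def IsDynSeparated {M : Type*} [MetricSpace M] {p n : ℕ} (g : Fin p → M → M)
    (w : Fin n → Fin p) (ε : ℝ) (K : Set M) : Prop :=
  K.Pairwise fun x y => ε < dynDist g w x y

/-- The maximal cardinality of a set that is separated at scale `ε` along the word `w`. -/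
noncomputable def maxSeparated {M : Type*} [MetricSpace M] {p n : ℕ} (g : Fin p → M → M)
    (w : Fin n → Fin p) (ε : ℝ) : ℕ∞ :=
  ⨆ (K : Set M) (_ : IsDynSeparated g w ε K), K.encard

/-- The growth rate `limsup (1/n) log ((1/p^n) ∑_{|w| = n} s(w, n, ε))` at scale `ε`. -/
noncomputable def entropyAtScale {M : Type*} [MetricSpace M] {p : ℕ} (g : Fin p → M → M)
    (ε : ℝ) : EReal :=
  limsup (fun n : ℕ =>
    ENNReal.log (wordAverage p n fun w => (maxSeparated g w ε : ℝ≥0∞)) / (n : EReal)) atTop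

/-- The topological entropy of the semigroup action generated by `g`, the limit as `ε → 0⁺` of the
growth rates at scale `ε`. -/
noncomputable def topEntropy {M : Type*} [MetricSpace M] {p : ℕ} (g : Fin p → M → M) : EReal :=
  limUnder (𝓝[>] (0 : ℝ)) (entropyAtScale g)

theorem entropyAtScale_antitone {M : Type*} [MetricSpace M] {p : ℕ} (g : Fin p → M → M) :
    Antitone (entropyAtScale g) := by
  intro ε ε' h
  refine limsup_le_limsup (Eventually.of_forall fun n => ?_)
  refine EReal.monotone_div_right_of_nonneg n.cast_nonneg' (ENNReal.log_monotone ?_)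
  refine ENNReal.div_le_div_right (Finset.sum_le_sum fun w _ => ?_) _
  refine ENat.toENNReal_le.2 (iSup₂_mono' fun K hK => ⟨K, ?_, le_rfl⟩)
  exact fun x hx y hy hxy => h.trans_lt (hK hx hy hxy)

/-- The limit that defines the topological entropy exists in `[-∞, ∞]`. -/
theorem tendsto_topEntropy {M : Type*} [MetricSpace M] {p : ℕ} (g : Fin p → M → M) :
    Tendsto (entropyAtScale g) (𝓝[>] (0 : ℝ)) (𝓝 (topEntropy g)) :=
  tendsto_nhds_limUnder ⟨_, (entropyAtScale_antitone g).tendsto_nhdsGT 0⟩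

/-! ### Averaged number of fixed points -/

/-- `N_n = (1/p^n) ∑_{|w| = n} #Fix(g_w)`. -/
noncomputable def averageFix {M : Type*} {p : ℕ} (g : Fin p → M → M) (n : ℕ) : ℝ≥0∞ :=
  wordAverage p n fun w => ((Function.fixedPoints (wordMap g w)).encard : ℝ≥0∞)

/-! ### Transfer operators -/

/-- The sum of `f` over a fibre of a local homeomorphism of a compact Hausdorff space (all the
fibres are finite) is a continuous function of the base point. -/
theorem continuous_fiberSum {M : Type*} [TopologicalSpace M] [T2Space M] [CompactSpace M]
    {T : M → M} (hT : IsLocalHomeomorph T) {f : M → ℝ} (hf : Continuous f) :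
    Continuous fun x => ∑ᶠ y : T ⁻¹' {x}, f y := by
  rw [continuous_iff_continuousAt]
  intro x
  obtain ⟨hd, U, hxU, hU, -, H, hH⟩ := (isLocalHomeomorph_iff_isCoveringMap.1 hT) x
  have hcpt : CompactSpace (T ⁻¹' {x}) :=
    isCompact_iff_compactSpace.1 ((isClosed_singleton.preimage hT.continuous).isCompact)
  have hfin : Finite (T ⁻¹' {x}) := finite_of_compact_of_discrete
  have := Fintype.ofFinite (T ⁻¹' {x})
  refine ContinuousOn.continuousAt (s := U) ?_ (hU.mem_nhds hxU)
  rw [continuousOn_iff_continuous_domRestrict]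
  have key : U.domRestrict (fun x => ∑ᶠ y : T ⁻¹' {x}, f y) =
      fun z : U => ∑ i : T ⁻¹' {x}, f (H.symm (z, i)) := by
    funext z
    rw [← finsum_eq_sum_of_fintype]
    refine (finsum_eq_of_bijective
      (fun i => (⟨H.symm (z, i), by simp [← hH]⟩ : T ⁻¹' {(z : M)})) ⟨?_, ?_⟩ ?_).symm
    · intro i j hij
      have h1 : H.symm (z, i) = H.symm (z, j) :=
        Subtype.ext (congrArg (fun y : T ⁻¹' {(z : M)} => (y : M)) hij)
      exact (Prod.ext_iff.1 (H.symm.injective h1)).2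
    · rintro ⟨y, hy⟩
      have hyU : y ∈ T ⁻¹' U := by
        rw [Set.mem_preimage, (hy : T y = z)]
        exact z.2
      refine ⟨(H ⟨y, hyU⟩).2, Subtype.ext ?_⟩
      have h1 : (H ⟨y, hyU⟩).1 = z := Subtype.ext ((hH ⟨y, hyU⟩).trans hy)
      change ((H.symm (z, (H ⟨y, hyU⟩).2) : T ⁻¹' U) : M) = y
      rw [← h1]
      simp
    · intro i
      rfl
  rw [key]
  fun_prop

theorem finite_fiber {M : Type*} [TopologicalSpace M] [T2Space M] [CompactSpace M]
    {T : M → M} (hT : IsLocalHomeomorph T) (x : M) : Finite (T ⁻¹' {x}) := by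
  have hd := ((isLocalHomeomorph_iff_isCoveringMap.1 hT) x).1
  have hcpt : CompactSpace (T ⁻¹' {x}) :=
    isCompact_iff_compactSpace.1 ((isClosed_singleton.preimage hT.continuous).isCompact)
  exact finite_of_compact_of_discrete

/-- The Ruelle-Perron-Frobenius operator of `T` with potential `φ`, as a linear map of `C⁰(M)`:
`(L ψ)(x) = ∑_{T y = x} exp (φ y) * ψ y`. -/
noncomputable def transferLinear {M : Type*} [MetricSpace M] [CompactSpace M] {T : M → M}
    (hT : IsLocalHomeomorph T) (φ : C(M, ℝ)) : C(M, ℝ) →ₗ[ℝ] C(M, ℝ) where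
  toFun ψ := ⟨fun x => ∑ᶠ y : T ⁻¹' {x}, Real.exp (φ y) * ψ y,
    continuous_fiberSum hT (f := fun y => Real.exp (φ y) * ψ y) (by fun_prop)⟩
  map_add' ψ₁ ψ₂ := by
    ext x
    have := finite_fiber hT x
    simp only [ContinuousMap.coe_mk, ContinuousMap.add_apply, mul_add]
    exact finsum_add_distrib (Set.toFinite _) (Set.toFinite _)
  map_smul' a ψ := by
    ext x
    have := finite_fiber hT x
    simp only [ContinuousMap.coe_mk, ContinuousMap.smul_apply, smul_eq_mul, RingHom.id_apply]
    rw [mul_finsum' _ _ (Set.toFinite _)]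
    exact finsum_congr fun y => by ring

/-- The Ruelle-Perron-Frobenius operator of `T` with potential `φ`, as a bounded linear operator
of `C⁰(M)`: `(L ψ)(x) = ∑_{T y = x} exp (φ y) * ψ y`. -/
noncomputable def transferOperator {M : Type*} [MetricSpace M] [CompactSpace M] {T : M → M}
    (hT : IsLocalHomeomorph T) (φ : C(M, ℝ)) : C(M, ℝ) →L[ℝ] C(M, ℝ) :=
  (transferLinear hT φ).mkContinuous ‖transferLinear hT φ 1‖ fun ψ => by
    rw [ContinuousMap.norm_le _ (by positivity)]
    intro x
    have := finite_fiber hT x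
    have := Fintype.ofFinite (T ⁻¹' {x})
    have h1 : |transferLinear hT φ ψ x| ≤ transferLinear hT φ 1 x * ‖ψ‖ := by
      simp only [transferLinear, LinearMap.coe_mk, AddHom.coe_mk, ContinuousMap.coe_mk,
        finsum_eq_sum_of_fintype, ContinuousMap.one_apply, mul_one]
      rw [Finset.sum_mul]
      refine (Finset.abs_sum_le_sum_abs _ _).trans (Finset.sum_le_sum fun y _ => ?_)
      rw [abs_mul, abs_of_pos (Real.exp_pos _)]
      exact mul_le_mul_of_nonneg_left (ψ.norm_coe_le_norm y) (Real.exp_pos _).le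
    refine h1.trans (mul_le_mul_of_nonneg_right ?_ (norm_nonneg _))
    exact (le_abs_self _).trans ((transferLinear hT φ 1).norm_coe_le_norm x)

theorem transferOperator_apply {M : Type*} [MetricSpace M] [CompactSpace M] {T : M → M}
    (hT : IsLocalHomeomorph T) (φ ψ : C(M, ℝ)) (x : M) :
    transferOperator hT φ ψ x = ∑ᶠ y : T ⁻¹' {x}, Real.exp (φ y) * ψ y :=
  rfl

/-- The sum `φ_w = ∑_{0 ≤ m < n} φ ∘ (g_{w_m} ∘ ⋯ ∘ g_{w_1})` of the potential `φ` along a word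
`w` of length `n`. -/
noncomputable def wordPotential {M : Type*} [MetricSpace M] {p n : ℕ} {g : Fin p → M → M}
    (hg : ∀ i, IsLocalHomeomorph (g i)) (φ : C(M, ℝ)) (w : Fin n → Fin p) : C(M, ℝ) :=
  ∑ m ∈ Finset.range n,
    φ.comp ⟨prefixMap g w m, (isLocalHomeomorph_compList hg ((List.ofFn w).take m)).continuous⟩

/-- The Ruelle-Perron-Frobenius sequence
`L_{n, φ} = (1/p^n) ∑_{|w| = n} (transfer operator of g_w with potential φ_w)`. -/
noncomputable def averagedTransfer {M : Type*} [MetricSpace M] [CompactSpace M] {p : ℕ}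
    {g : Fin p → M → M} (hg : ∀ i, IsLocalHomeomorph (g i)) (φ : C(M, ℝ)) (n : ℕ) :
    C(M, ℝ) →L[ℝ] C(M, ℝ) :=
  ((p : ℝ) ^ n)⁻¹ • ∑ w : Fin n → Fin p,
    transferOperator (T := wordMap g w) (isLocalHomeomorph_compList hg (List.ofFn w))
      (wordPotential hg φ w)

/-- The spectral radius in `[0, ∞]` of a sequence of positive operators of `C⁰(M)`, given by
`log sp = limsup (1/n) log ‖L_n 1‖`. -/
noncomputable def sequenceSpectralRadius {M : Type*} [MetricSpace M] [CompactSpace M]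
    (L : ℕ → C(M, ℝ) →L[ℝ] C(M, ℝ)) : ℝ≥0∞ :=
  EReal.exp (limsup (fun n : ℕ => ENNReal.log ‖L n 1‖ₑ / (n : EReal)) atTop)

end SemigroupAction

namespace SemigroupAction

/-! Each generator is a covering map of the connected space `M`, so all its fibres have the same
number d_i of points, and every fibre of g_w has ∏ d_{w_j} points. The average of these products
over words of length n is exactly a^n with a = (∑ d_i)/p, since (∑ d_i)^n expands over words. Each
quantity in the theorem agrees with a^n up to constant factors independent of n, so its rate is log
a; moreover a ≥ 2, by `two_le_degree`.

The operators satisfy L_n 1 = a^n. For separated sets, a fibre of g_w is itself separated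
(`prod_le_maxSeparated`), while inverse branches let the preimage of a finite net shadow every orbit
(`exists_maxSeparated_le`). Fixed points are separated at scale r/2; conversely, long words map
small balls onto `M`, and the contraction principle turns the preimages of a point into fixed
points, at the cost of the degrees of boundedly many letters (`exists_prod_le_encard_fixedPoints`).
-/

/-- The generators are Ruelle-expanding with common constants. -/
structure IsUniformlyExpanding {M : Type*} [MetricSpace M] {p : ℕ} (g : Fin p → M → M)
    (c r ρ : ℝ) : Prop where
  r_pos : 0 < r
  r_le : r ≤ c
  rho_pos : 0 < ρ
  rho_lt_one : ρ < 1
  separated : ∀ i x y, x ≠ y → g i x = g i y → c < dist x y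
  inverse_branch : ∀ i x a, g i a = x → ∃ φ : M → M, φ x = a ∧
    (∀ z ∈ Metric.ball x r, g i (φ z) = z) ∧
      ∀ z ∈ Metric.ball x r, ∀ w ∈ Metric.ball x r, dist (φ z) (φ w) ≤ ρ * dist z w

theorem exists_isUniformlyExpanding {M : Type*} [MetricSpace M] {p : ℕ} (hp : 1 ≤ p)
    {g : Fin p → M → M} (hg : ∀ i, IsRuelleExpanding (g i)) :
    ∃ c r ρ : ℝ, IsUniformlyExpanding g c r ρ := by
  have : Nonempty (Fin p) := ⟨⟨0, hp⟩⟩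
  choose c hc hsep using fun i => (hg i).separated
  choose r ρ hr hρ hρ1 hbr using fun i => (hg i).inverse_branch
  obtain ⟨ic, hic⟩ := Finite.exists_min c
  obtain ⟨ir, hir⟩ := Finite.exists_min r
  obtain ⟨iρ, hiρ⟩ := Finite.exists_max ρ
  -- Shrinking r below c makes two orbits that stay within r of each other and end at the same point
  -- coincide.
  refine ⟨c ic, min (r ir) (c ic), ρ iρ, lt_min (hr ir) (hc ic), min_le_right _ _, hρ iρ, hρ1 iρ,
    fun i x y hxy h => (hic i).trans_lt (hsep i x y hxy h), fun i x a h => ?_⟩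
  obtain ⟨φ, h1, h2, h3⟩ := hbr i x a h
  have hsub : Metric.ball x (min (r ir) (c ic)) ⊆ Metric.ball x (r i) :=
    Metric.ball_subset_ball ((min_le_left _ _).trans (hir i))
  exact ⟨φ, h1, fun z hz => h2 z (hsub hz), fun z hz w hw =>
    (h3 z (hsub hz) w (hsub hw)).trans (mul_le_mul_of_nonneg_right (hiρ i) dist_nonneg)⟩

theorem compList_append {M : Type*} {p : ℕ} (g : Fin p → M → M) (l l' : List (Fin p)) :
    compList g (l ++ l') = compList g l' ∘ compList g l := by
  induction l with
  | nil => rfl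
  | cons i l ih => rw [List.cons_append, compList, ih]; rfl

/-! ### Inverse branches along words -/

namespace IsUniformlyExpanding

variable {M : Type*} [MetricSpace M] {p : ℕ} {g : Fin p → M → M} {c r ρ : ℝ}

/-- One-step branches compose because contraction keeps the image of the ball inside the ball where
the next branch is defined. The last clause is the shadowing property: at every time j the orbits of
the two lifts are still images under a branch of the remaining word. -/
theorem exists_branch (h : IsUniformlyExpanding g c r ρ) (l : List (Fin p)) {x a : M}
    (ha : compList g l a = x) :
    ∃ φ : M → M, φ x = a ∧ (∀ z ∈ Metric.ball x r, compList g l (φ z) = z) ∧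
      (∀ z ∈ Metric.ball x r, ∀ w ∈ Metric.ball x r,
        dist (φ z) (φ w) ≤ ρ ^ l.length * dist z w) ∧
      ∀ z ∈ Metric.ball x r, ∀ w ∈ Metric.ball x r, ∀ j,
        dist (compList g (l.take j) (φ z)) (compList g (l.take j) (φ w)) ≤ dist z w := by
  induction l generalizing a with
  | nil => exact ⟨id, ha.symm, fun z _ => rfl, by simp, by simp [compList]⟩
  | cons i l ih =>
    obtain ⟨φ, h1, h2, h3, h4⟩ := ih (a := g i a) ha
    obtain ⟨ψ, k1, k2, k3⟩ := h.inverse_branch i (g i a) a rfl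
    have hmem : ∀ z ∈ Metric.ball x r, φ z ∈ Metric.ball (g i a) r := by
      intro z hz
      have := h3 z hz x (Metric.mem_ball_self h.r_pos)
      rw [h1] at this
      refine (this.trans (mul_le_of_le_one_left dist_nonneg ?_)).trans_lt hz
      exact pow_le_one₀ h.rho_pos.le h.rho_lt_one.le
    have h5 : ∀ z ∈ Metric.ball x r, ∀ w ∈ Metric.ball x r,
        dist (ψ (φ z)) (ψ (φ w)) ≤ ρ ^ (i :: l).length * dist z w := by
      intro z hz w hw
      refine (k3 _ (hmem z hz) _ (hmem w hw)).trans ?_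
      rw [List.length_cons, pow_succ', mul_assoc]
      exact mul_le_mul_of_nonneg_left (h3 z hz w hw) h.rho_pos.le
    refine ⟨ψ ∘ φ, by simp [h1, k1], fun z hz => ?_, h5, fun z hz w hw j => ?_⟩
    · simp [compList, k2 _ (hmem z hz), h2 z hz]
    · cases j with
      | zero =>
        refine (h5 z hz w hw).trans (mul_le_of_le_one_left dist_nonneg ?_)
        exact pow_le_one₀ h.rho_pos.le h.rho_lt_one.le
      | succ j =>
        simpa [compList, k2 _ (hmem z hz), k2 _ (hmem w hw)] using h4 z hz w hw j

/-- Just before the two orbits merge, they are at distinct points with the same image under a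
generator. -/
theorem exists_lt_dist (h : IsUniformlyExpanding g c r ρ) (l : List (Fin p)) {x y : M}
    (hne : x ≠ y) (hxy : compList g l x = compList g l y) :
    ∃ j ≤ l.length, c < dist (compList g (l.take j) x) (compList g (l.take j) y) := by
  induction l generalizing x y with
  | nil => exact absurd hxy hne
  | cons i l ih =>
    by_cases hi : g i x = g i y
    · exact ⟨0, Nat.zero_le _, h.separated i x y hne hi⟩
    · obtain ⟨j, hj, hd⟩ := ih hi hxy
      exact ⟨j + 1, Nat.succ_le_succ hj, hd⟩

end IsUniformlyExpanding

/-! ### Chains and mixing -/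

/-- The points reached by chains from x form a nonempty clopen set. Chains may idle, so the sets
reached in K steps increase, and compactness makes one K suffice. -/
theorem exists_chain_from {M : Type*} [MetricSpace M] [CompactSpace M] [ConnectedSpace M] {r : ℝ}
    (hr : 0 < r) (x : M) :
    ∃ K : ℕ, ∀ y : M, ∃ u : ℕ → M, u 0 = x ∧ u K = y ∧ ∀ k, dist (u k) (u (k + 1)) < r := by
  let R : ℕ → Set M := fun K =>
    {y | ∃ u : ℕ → M, u 0 = x ∧ u K = y ∧ ∀ k, dist (u k) (u (k + 1)) < r}
  have hstep : ∀ K y z, y ∈ R K → dist y z < r → z ∈ R (K + 1) := by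
    rintro K y z ⟨u, hu0, huK, hu⟩ hyz
    refine ⟨fun k => if k ≤ K then u k else z, by simpa using hu0, by simp, fun k => ?_⟩
    rcases lt_trichotomy k K with hk | hk | hk
    · simpa [hk.le, Nat.succ_le_of_lt hk] using hu k
    · subst hk; simpa [huK] using hyz
    · simpa [not_le.2 hk, not_le.2 (hk.trans (Nat.lt_succ_self k))] using hr
  have hmono : Monotone R := monotone_nat_of_le_succ fun K y hy =>
    hstep K y y hy (by simpa using hr)
  have hopen : IsOpen (⋃ K, R K) := by
    refine Metric.isOpen_iff.2 fun y hy => ?_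
    obtain ⟨K, hK⟩ := mem_iUnion.1 hy
    exact ⟨r, hr, fun z hz => mem_iUnion.2 ⟨K + 1, hstep K y z hK (Metric.mem_ball'.1 hz)⟩⟩
  have hclosed : IsClosed (⋃ K, R K) := by
    refine isClosed_of_closure_subset fun y hy => ?_
    obtain ⟨z, hz, hyz⟩ := Metric.mem_closure_iff.1 hy r hr
    obtain ⟨K, hK⟩ := mem_iUnion.1 hz
    exact mem_iUnion.2 ⟨K + 1, hstep K z y hK (by rwa [dist_comm])⟩
  have huniv : (⋃ K, R K) = univ :=
    IsClopen.eq_univ ⟨hclosed, hopen⟩ ⟨x, mem_iUnion.2 ⟨0, fun _ => x, rfl, rfl, by simpa⟩⟩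
  have hcover : (univ : Set M) ⊆ ⋃ K, interior (R K) := by
    intro y _
    obtain ⟨K, hK⟩ := mem_iUnion.1 (huniv.ge (mem_univ y))
    refine mem_iUnion.2 ⟨K + 1, mem_interior_iff_mem_nhds.2 ?_⟩
    exact mem_of_superset (Metric.ball_mem_nhds y hr)
      fun z hz => hstep K y z hK (Metric.mem_ball'.1 hz)
  obtain ⟨K, hK⟩ := isCompact_univ.elim_directed_cover _ (fun _ => isOpen_interior) hcover
    (directed_of_isDirected_le fun a b hab => interior_mono (hmono hab))
  exact ⟨K, fun y => (interior_subset (hK (mem_univ y)) : y ∈ R K)⟩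

/-- In a compact connected space, any two points are joined by a chain of uniformly bounded
length. -/
theorem exists_chain {M : Type*} [MetricSpace M] [CompactSpace M] [ConnectedSpace M] {r : ℝ}
    (hr : 0 < r) :
    ∃ K : ℕ, ∀ x y : M, ∃ u : ℕ → M, u 0 = x ∧ u K = y ∧ ∀ k < K, dist (u k) (u (k + 1)) < r := by
  obtain ⟨x₀⟩ := (inferInstance : Nonempty M)
  obtain ⟨K, hK⟩ := exists_chain_from hr x₀
  refine ⟨K + K, fun x y => ?_⟩
  obtain ⟨u, hu0, huK, hu⟩ := hK x
  obtain ⟨v, hv0, hvK, hv⟩ := hK y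
  -- The chain from the base point to x, reversed, followed by the one from the base point to y.
  refine ⟨fun k => if k ≤ K then u (K - k) else v (k - K), by simpa using huK, ?_, fun k _ => ?_⟩
  · rcases Nat.eq_zero_or_pos K with rfl | hpos
    · simp only [add_zero, le_refl, if_true, Nat.sub_self]
      rw [hu0, ← hv0, hvK]
    · simp [hpos.ne', hvK]
  · rcases lt_trichotomy k K with hk | hk | hk
    · have := hu (K - (k + 1))
      rw [show K - (k + 1) + 1 = K - k by omega, dist_comm] at this
      simpa [hk.le, Nat.succ_le_of_lt hk] using this
    · subst hk
      simpa [hu0, ← hv0] using hv 0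
    · have := hv (k - K)
      rw [show k - K + 1 = k + 1 - K by omega] at this
      simpa [not_le.2 hk, not_le.2 (hk.trans (Nat.lt_succ_self k))] using this

/-- Long words map every ball of a given radius onto the whole space. -/
theorem IsUniformlyExpanding.exists_preimage_mem_ball {M : Type*} [MetricSpace M] [CompactSpace M]
    [ConnectedSpace M] {p : ℕ} {g : Fin p → M → M} {c r ρ : ℝ} (h : IsUniformlyExpanding g c r ρ)
    {δ : ℝ} (hδ : 0 < δ) :
    ∃ N : ℕ, ∀ l : List (Fin p), N ≤ l.length → ∀ x z : M,
      ∃ a ∈ Metric.ball x δ, compList g l a = z := by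
  obtain ⟨K, hK⟩ := exists_chain (M := M) h.r_pos
  -- Lifting a chain of K steps through the branches moves the preimage by at most r * ρ^n per step.
  have hlim : Tendsto (fun n : ℕ => (K * r) * ρ ^ n) atTop (𝓝 ((K * r) * 0)) :=
    (tendsto_pow_atTop_nhds_zero_of_lt_one h.rho_pos.le h.rho_lt_one).const_mul _
  rw [mul_zero] at hlim
  obtain ⟨N, hN⟩ := eventually_atTop.1 (hlim.eventually_lt_const hδ)
  refine ⟨N, fun l hl x z => ?_⟩
  obtain ⟨u, hu0, huK, hu⟩ := hK (compList g l x) z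
  have key : ∀ k ≤ K, ∃ a, compList g l a = u k ∧ dist a x ≤ (k * r) * ρ ^ l.length := by
    intro k
    induction k with
    | zero => exact fun _ => ⟨x, hu0.symm, by simp⟩
    | succ k ih =>
      intro hk
      obtain ⟨a, ha, had⟩ := ih (by omega)
      obtain ⟨φ, h1, h2, h3, -⟩ := h.exists_branch l ha
      have hd := hu k (by omega)
      have hmem : u (k + 1) ∈ Metric.ball (u k) r := Metric.mem_ball'.2 hd
      refine ⟨φ (u (k + 1)), h2 _ hmem, ?_⟩
      have h4 := h3 _ hmem _ (Metric.mem_ball_self h.r_pos)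
      rw [h1] at h4
      have h5 : ρ ^ l.length * dist (u (k + 1)) (u k) ≤ ρ ^ l.length * r :=
        mul_le_mul_of_nonneg_left (Metric.mem_ball.1 hmem).le (pow_nonneg h.rho_pos.le _)
      have h6 := dist_triangle (φ (u (k + 1))) a x
      push_cast
      linarith
  obtain ⟨a, ha, had⟩ := key K le_rfl
  exact ⟨a, had.trans_lt (hN _ hl), ha.trans huK⟩

/-! ### Degrees -/

theorem encard_preimage_of_encard_fiber {X Y : Type*} {T : X → Y} {d : ℕ}
    (hd : ∀ x, (T ⁻¹' {x}).encard = d) {F : Set Y} (hF : F.Finite) :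
    (T ⁻¹' F).encard = d * F.encard := by
  induction F, hF using Set.Finite.induction_on with
  | empty => simp
  | @insert x F hx _ ih =>
    rw [Set.insert_eq, preimage_union, encard_union_eq, hd, ih, ← Set.insert_eq,
      encard_insert_of_notMem hx, mul_add, mul_one, add_comm]
    exact Disjoint.preimage T (disjoint_singleton_left.2 hx)

/-- The fibres of a local homeomorphism of a compact connected space have the same cardinality. -/
theorem exists_encard_fiber_eq {M : Type*} [MetricSpace M] [CompactSpace M] [ConnectedSpace M]
    {T : M → M} (hT : IsLocalHomeomorph T) : ∃ d : ℕ, ∀ x, (T ⁻¹' {x}).encard = d := by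
  -- The cardinality is the fibre sum of 1, hence continuous; being integer-valued on a connected
  -- space, it is constant.
  have hcast : ∀ x, ∑ᶠ _ : T ⁻¹' {x}, (1 : ℝ) = ((T ⁻¹' {x}).ncard : ℝ) := by
    intro x
    have := finite_fiber hT x
    have := Fintype.ofFinite (T ⁻¹' {x})
    rw [finsum_eq_sum_of_fintype, ← Nat.card_coe_set_eq]
    simp
  have hcont : Continuous fun x => ((T ⁻¹' {x}).ncard : ℝ) := by
    simpa only [hcast] using continuous_fiberSum hT (f := fun _ => (1 : ℝ)) continuous_const
  have hcont' : Continuous fun x => (T ⁻¹' {x}).ncard :=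
    Nat.isClosedEmbedding_coe_real.isInducing.continuous_iff.2 hcont
  obtain ⟨x₀⟩ := (inferInstance : Nonempty M)
  refine ⟨(T ⁻¹' {x₀}).ncard, fun x => ?_⟩
  have := finite_fiber hT x
  rw [← (Set.toFinite (T ⁻¹' {x})).cast_ncard_eq]
  exact congrArg _ (PreconnectedSpace.constant inferInstance hcont')

theorem encard_fiber_compList {M : Type*} {p : ℕ} {g : Fin p → M → M} {d : Fin p → ℕ}
    (hd : ∀ i x, (g i ⁻¹' {x}).encard = d i) (l : List (Fin p)) (x : M) :
    (compList g l ⁻¹' {x}).encard = ((l.map d).prod : ℕ) := by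
  induction l with
  | nil => simp [compList]
  | cons i l ih =>
    have hfin : (compList g l ⁻¹' {x}).Finite := finite_of_encard_eq_coe ih
    rw [compList, preimage_comp, encard_preimage_of_encard_fiber (hd i) hfin, ih]
    simp

namespace IsUniformlyExpanding

variable {M : Type*} [MetricSpace M] {p : ℕ} {g : Fin p → M → M} {c r ρ : ℝ} {d : Fin p → ℕ}

/-- With degree at most 1 all iterates would be injective. But a high iterate maps the open ball
about x of radius d(x, y), which misses y, onto `M`, so some point of the ball has the same image as
y. -/
theorem two_le_degree [CompactSpace M] [ConnectedSpace M] [Nontrivial M]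
    (h : IsUniformlyExpanding g c r ρ) (hd : ∀ i x, (g i ⁻¹' {x}).encard = d i) (i : Fin p) :
    2 ≤ d i := by
  obtain ⟨x, y, hxy⟩ := exists_pair_ne M
  obtain ⟨N, hN⟩ := h.exists_preimage_mem_ball (dist_pos.2 hxy)
  obtain ⟨a, ha, hay⟩ := hN (List.replicate N i) (by simp) x
    (compList g (List.replicate N i) y)
  have hne : a ≠ y := by
    rintro rfl
    exact absurd (Metric.mem_ball'.1 ha) (lt_irrefl _)
  have h1 : 1 < (compList g (List.replicate N i) ⁻¹' {compList g (List.replicate N i) y}).encard :=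
    one_lt_encard_iff.2 ⟨a, y, hay, rfl, hne⟩
  rw [encard_fiber_compList hd] at h1
  by_contra hlt
  have h2 : (List.map d (List.replicate N i)).prod ≤ 1 := by
    rw [List.map_replicate, List.prod_replicate]
    exact pow_le_one₀ (Nat.zero_le _) (by omega)
  exact absurd (Nat.cast_lt.1 (by exact_mod_cast h1 :
    ((1 : ℕ) : ℕ∞) < ((List.map d (List.replicate N i)).prod : ℕ))) (not_lt.2 h2)

/-! ### Separated sets and fixed points -/

theorem prod_le_maxSeparated [Nonempty M] (h : IsUniformlyExpanding g c r ρ)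
    (hd : ∀ i x, (g i ⁻¹' {x}).encard = d i) {ε : ℝ} (hε : ε ≤ c) {n : ℕ} (w : Fin n → Fin p) :
    ((∏ j, d (w j) : ℕ) : ℕ∞) ≤ maxSeparated g w ε := by
  obtain ⟨x⟩ := ‹Nonempty M›
  have hprod : ((List.ofFn w).map d).prod = ∏ j, d (w j) := by
    rw [List.map_ofFn, List.prod_ofFn]
    rfl
  rw [← hprod, ← encard_fiber_compList hd _ x]
  refine le_iSup₂_of_le (compList g (List.ofFn w) ⁻¹' {x}) ?_ le_rfl
  intro a ha b hb hab
  obtain ⟨j, hj, hlt⟩ := h.exists_lt_dist (List.ofFn w) hab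
    ((mem_singleton_iff.1 ha).trans (mem_singleton_iff.1 hb).symm)
  refine (Finset.lt_sup'_iff _).2 ⟨j, ?_, hε.trans_lt hlt⟩
  simpa [Nat.lt_succ_iff] using hj

theorem exists_maxSeparated_le [CompactSpace M] (h : IsUniformlyExpanding g c r ρ)
    (hd : ∀ i x, (g i ⁻¹' {x}).encard = d i) {ε : ℝ} (hε : 0 < ε) :
    ∃ C : ℕ, ∀ (n : ℕ) (w : Fin n → Fin p), maxSeparated g w ε ≤ ((C * ∏ j, d (w j) : ℕ) : ℕ∞) := by
  -- The bound r puts the net point in the domain of the branch; ε / 2 lets two points with the same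
  -- shadow be compared.
  have hδ : 0 < min r (ε / 2) := lt_min h.r_pos (half_pos hε)
  obtain ⟨t, -, ht, hcov⟩ := finite_cover_balls_of_compact (isCompact_univ (X := M)) hδ
  refine ⟨t.ncard, fun n w => iSup₂_le fun K hK => ?_⟩
  have key : ∀ x : M, ∃ a ∈ compList g (List.ofFn w) ⁻¹' t, ∀ j,
      dist (prefixMap g w j x) (prefixMap g w j a) ≤ ε / 2 := by
    intro x
    obtain ⟨z, hz, hxz⟩ := mem_iUnion₂.1 (hcov (mem_univ (compList g (List.ofFn w) x)))
    obtain ⟨φ, h1, h2, -, h4⟩ := h.exists_branch (List.ofFn w) (a := x) rfl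
    have hmem : z ∈ Metric.ball (compList g (List.ofFn w) x) r :=
      Metric.mem_ball'.2 ((Metric.mem_ball.1 hxz).trans_le (min_le_left _ _))
    refine ⟨φ z, by simpa [h2 z hmem] using hz, fun j => ?_⟩
    have h5 := h4 _ (Metric.mem_ball_self h.r_pos) z hmem j
    rw [h1] at h5
    exact h5.trans ((Metric.mem_ball.1 hxz).le.trans (min_le_right _ _))
  choose f hf hfd using key
  have hinj : InjOn f K := by
    intro x hx y hy hxy
    by_contra hne
    obtain ⟨j, -, hlt⟩ := (Finset.lt_sup'_iff _).1 (hK hx hy hne)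
    have h1 := hfd x j
    have h2 := hfd y j
    rw [← hxy] at h2
    have h3 := dist_triangle_right (prefixMap g w j x) (prefixMap g w j y) (prefixMap g w j (f x))
    linarith
  refine (encard_le_encard_of_injOn (fun x _ => hf x) hinj).trans ?_
  rw [encard_preimage_of_encard_fiber (encard_fiber_compList hd _) ht, ← ht.cast_ncard_eq,
    List.map_ofFn, List.prod_ofFn, mul_comm, Nat.cast_mul]
  rfl

/-- Let fixed points x, y stay within r/2, and let φ be the branch of g_w fixing x. The orbits of
φ(y) and y stay within r ≤ c and end at y, so φ(y) = y. Then φ fixes two points while contracting by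
ρ^n < 1, which is where n ≠ 0 enters. -/
theorem encard_fixedPoints_le_maxSeparated (h : IsUniformlyExpanding g c r ρ) {n : ℕ} (hn : n ≠ 0)
    (w : Fin n → Fin p) :
    (Function.fixedPoints (wordMap g w)).encard ≤ maxSeparated g w (r / 2) := by
  refine le_iSup₂_of_le _ ?_ le_rfl
  intro x hx y hy hxy
  by_contra hlt
  have hle : ∀ j ≤ n, dist (prefixMap g w j x) (prefixMap g w j y) ≤ r / 2 := fun j hj =>
    (Finset.sup'_le_iff _ _).1 (not_lt.1 hlt) j (Finset.mem_range_succ_iff.2 hj)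
  have hr := h.r_pos
  have hxy2 : dist x y ≤ r / 2 := hle 0 (Nat.zero_le _)
  have hy_mem : y ∈ Metric.ball x r := Metric.mem_ball'.2 (by linarith)
  have hx_mem : x ∈ Metric.ball x r := Metric.mem_ball_self hr
  obtain ⟨φ, h1, h2, h3, h4⟩ := h.exists_branch (List.ofFn w) (x := x) (a := x) hx
  have hφy : φ y = y := by
    by_contra hne
    obtain ⟨j, hj, hc⟩ := h.exists_lt_dist (List.ofFn w) hne ((h2 y hy_mem).trans hy.symm)
    have h5 := h4 y hy_mem x hx_mem j
    rw [h1, dist_comm y x] at h5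
    have h6 := hle j (by simpa using hj)
    have h7 := dist_triangle (compList g ((List.ofFn w).take j) (φ y))
      (compList g ((List.ofFn w).take j) x) (compList g ((List.ofFn w).take j) y)
    have h8 := h.r_le
    unfold prefixMap at h6
    linarith
  have h5 := h3 x hx_mem y hy_mem
  rw [h1, hφy, List.length_ofFn] at h5
  have h6 : ρ ^ n < 1 := pow_lt_one₀ h.rho_pos.le h.rho_lt_one hn
  nlinarith [dist_pos.2 hxy]

/-- The first N letters are used to return near x₀: each b in the fibre over x₀ of the remaining
word is the image under them of some a near x₀. The branch of the whole word taking x₀ to a maps a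
ball about x₀ into itself and has a fixed point there, whose orbit shadows that of a and so
determines b. -/
theorem exists_prod_le_encard_fixedPoints [CompactSpace M] [ConnectedSpace M]
    (h : IsUniformlyExpanding g c r ρ) (hd : ∀ i x, (g i ⁻¹' {x}).encard = d i) :
    ∃ N : ℕ, ∀ l : List (Fin p), N ≤ l.length →
      (((l.drop N).map d).prod : ℕ) ≤ (Function.fixedPoints (compList g l)).encard := by
  have hr := h.r_pos
  obtain ⟨x₀⟩ := (inferInstance : Nonempty M)
  -- The radii fit: a branch contracting by 1/2 sends the closed ball of radius r/2 within r/4 of a,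
  -- and a lies within r/4 of x₀.
  obtain ⟨N, hN⟩ := h.exists_preimage_mem_ball (δ := r / 4) (by linarith)
  obtain ⟨N', hN'⟩ := exists_pow_lt_of_lt_one (show (0 : ℝ) < 1 / 2 by norm_num) h.rho_lt_one
  refine ⟨max N N', fun l hl => ?_⟩
  set L := max N N'
  have hsub : Metric.closedBall x₀ (r / 2) ⊆ Metric.ball x₀ r :=
    Metric.closedBall_subset_ball (by linarith)
  have hpow : ρ ^ l.length ≤ 1 / 2 :=
    (pow_le_pow_of_le_one h.rho_pos.le h.rho_lt_one.le
      ((le_max_right _ _).trans hl)).trans hN'.le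
  have hpow0 : 0 ≤ ρ ^ l.length := pow_nonneg h.rho_pos.le _
  have key : ∀ b : compList g (l.drop L) ⁻¹' {x₀}, ∃ a y : M, compList g (l.take L) a = b ∧
      compList g l a = x₀ ∧ compList g l y = y ∧
      ∀ j, dist (compList g (l.take j) y) (compList g (l.take j) a) ≤ r / 2 := by
    rintro ⟨b, hb⟩
    obtain ⟨a, ha, hab⟩ := hN (l.take L) (by simp [L] at hl ⊢; omega) x₀ b
    have hax : compList g l a = x₀ := by
      rw [← List.take_append_drop L l, compList_append, Function.comp_apply, hab]
      exact hb
    obtain ⟨φ, h1, h2, h3, h4⟩ := h.exists_branch l hax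
    have hmaps : MapsTo φ (Metric.closedBall x₀ (r / 2)) (Metric.closedBall x₀ (r / 2)) := by
      intro z hz
      have h5 := h3 z (hsub hz) x₀ (Metric.mem_ball_self hr)
      rw [h1] at h5
      have h6 := dist_triangle (φ z) a x₀
      have h7 := Metric.mem_closedBall.1 hz
      have h8 := Metric.mem_ball.1 ha
      refine Metric.mem_closedBall.2 ?_
      nlinarith [dist_nonneg (x := z) (y := x₀)]
    have hlip : LipschitzWith (1 / 2) (hmaps.restrict φ _ _) := by
      refine LipschitzWith.of_dist_le_mul fun z w => ?_
      refine (h3 z (hsub z.2) w (hsub w.2)).trans ?_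
      exact mul_le_mul_of_nonneg_right (by simpa using hpow) dist_nonneg
    have hcontr : ContractingWith (1 / 2) (hmaps.restrict φ _ _) :=
      ⟨by rw [div_lt_one] <;> norm_num, hlip⟩
    obtain ⟨y, hy, hyφ, -⟩ := hcontr.exists_fixedPoint' Metric.isClosed_closedBall.isComplete hmaps
      (Metric.mem_closedBall_self (by linarith : 0 ≤ r / 2)) (edist_ne_top _ _)
    refine ⟨a, y, hab, hax, ?_, fun j => ?_⟩
    · have := h2 y (hsub hy)
      rwa [hyφ.eq] at this
    · have h5 := h4 y (hsub hy) x₀ (Metric.mem_ball_self hr) j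
      rw [hyφ.eq, h1] at h5
      exact h5.trans (Metric.mem_closedBall.1 hy)
  choose a y hab hax hy hya using key
  have hinj : Function.Injective y := by
    intro b b' hbb
    -- Both orbits stay within r/2 of that of the common fixed point, hence within r ≤ c of each
    -- other.
    have haa : a b = a b' := by
      by_contra hne
      obtain ⟨j, -, hc⟩ := h.exists_lt_dist l hne ((hax b).trans (hax b').symm)
      have h1 := hya b j
      have h2 := hya b' j
      rw [← hbb] at h2
      have h3 := dist_triangle_left (compList g (l.take j) (a b)) (compList g (l.take j) (a b'))
        (compList g (l.take j) (y b))
      have h4 := h.r_le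
      linarith
    exact Subtype.ext ((hab b).symm.trans (haa ▸ hab b'))
  rw [← encard_fiber_compList hd _ x₀]
  have h1 : (range y).encard = (compList g (l.drop L) ⁻¹' {x₀}).encard := by
    rw [← image_univ, hinj.encard_image, encard_univ]
    rfl
  rw [← h1]
  exact encard_le_encard (range_subset_iff.2 hy)

end IsUniformlyExpanding

/-! ### Growth rates -/

/-- Constant factors contribute (log C)/n, which tends to 0. -/
theorem tendsto_log_div_of_le_of_le {F : ℕ → ℝ≥0∞} {a C₁ C₂ : ℝ≥0∞} (ha : a ≠ 0) (ha' : a ≠ ⊤)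
    (h₁ : C₁ ≠ 0) (h₁' : C₁ ≠ ⊤) (h₂ : C₂ ≠ 0) (h₂' : C₂ ≠ ⊤)
    (hl : ∀ᶠ n in atTop, C₁ * a ^ n ≤ F n) (hu : ∀ᶠ n in atTop, F n ≤ C₂ * a ^ n) :
    Tendsto (fun n : ℕ => ENNReal.log (F n) / (n : EReal)) atTop (𝓝 (ENNReal.log a)) := by
  have key : ∀ C : ℝ≥0∞, C ≠ 0 → C ≠ ⊤ →
      Tendsto (fun n : ℕ => ENNReal.log (C * a ^ n) / (n : EReal)) atTop (𝓝 (ENNReal.log a)) := by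
    intro C hC hC'
    rw [ENNReal.log_pos_real ha ha']
    have h1 : Tendsto (fun n : ℕ => Real.log C.toReal / n + Real.log a.toReal) atTop
        (𝓝 (0 + Real.log a.toReal)) :=
      (tendsto_const_div_atTop_nhds_zero_nat _).add_const _
    rw [zero_add] at h1
    refine ((continuous_coe_real_ereal.tendsto _).comp h1).congr' ?_
    filter_upwards [eventually_ne_atTop 0] with n hn
    have hn' : (n : ℝ) ≠ 0 := Nat.cast_ne_zero.2 hn
    rw [ENNReal.log_mul_add, ENNReal.log_pow, ENNReal.log_pos_real ha ha',
      ENNReal.log_pos_real hC hC', Function.comp_apply]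
    rw [← EReal.coe_coe_eq_natCast, ← EReal.coe_mul, ← EReal.coe_add, ← EReal.coe_div]
    congr 1
    field_simp
  refine tendsto_of_tendsto_of_tendsto_of_le_of_le' (key C₁ h₁ h₁') (key C₂ h₂ h₂') ?_ ?_
  · filter_upwards [hl] with n hn
    exact EReal.monotone_div_right_of_nonneg n.cast_nonneg' (ENNReal.log_monotone hn)
  · filter_upwards [hu] with n hn
    exact EReal.monotone_div_right_of_nonneg n.cast_nonneg' (ENNReal.log_monotone hn)

theorem wordAverage_mono {p n : ℕ} {F G : (Fin n → Fin p) → ℝ≥0∞} (h : ∀ w, F w ≤ G w) :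
    wordAverage p n F ≤ wordAverage p n G :=
  ENNReal.div_le_div_right (Finset.sum_le_sum fun w _ => h w) _

theorem wordAverage_const_mul_prod (p n : ℕ) (C : ℝ≥0∞) (d : Fin p → ℕ) :
    wordAverage p n (fun w => C * ((∏ j, d (w j) : ℕ) : ℝ≥0∞)) =
      C * ((∑ i, (d i : ℝ≥0∞)) / p) ^ n := by
  rw [wordAverage, ← Finset.mul_sum, mul_div_assoc, div_eq_mul_inv _ (p : ℝ≥0∞), mul_pow,
    Fintype.sum_pow (fun i => (d i : ℝ≥0∞)), ← ENNReal.inv_pow, div_eq_mul_inv]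
  push_cast
  rfl

/-- With zero potential the operator of g_w applied to 1 counts a fibre, so the average is a
constant function. -/
theorem averagedTransfer_zero_one_apply {M : Type*} [MetricSpace M] [CompactSpace M] {p : ℕ}
    {g : Fin p → M → M} (hg : ∀ i, IsLocalHomeomorph (g i)) {d : Fin p → ℕ}
    (hd : ∀ i x, (g i ⁻¹' {x}).encard = d i) (n : ℕ) (x : M) :
    averagedTransfer hg 0 n 1 x = ((∑ i, (d i : ℝ)) / p) ^ n := by
  have h1 : ∀ w : Fin n → Fin p, transferOperator (T := wordMap g w)
      (isLocalHomeomorph_compList hg (List.ofFn w)) (wordPotential hg 0 w) 1 x =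
        ∏ j, (d (w j) : ℝ) := by
    intro w
    have hloc : IsLocalHomeomorph (wordMap g w) := isLocalHomeomorph_compList hg (List.ofFn w)
    have := finite_fiber hloc x
    have := Fintype.ofFinite (wordMap g w ⁻¹' {x})
    have hcard : (wordMap g w ⁻¹' {x}).ncard = ∏ j, d (w j) := by
      rw [ncard_def, wordMap, encard_fiber_compList hd, List.map_ofFn, List.prod_ofFn]
      rfl
    have hpot : wordPotential hg 0 w = 0 := by
      simp [wordPotential]
    refine (transferOperator_apply hloc _ _ x).trans ?_
    rw [hpot, finsum_eq_sum_of_fintype, ← Nat.cast_prod, ← hcard, ← Nat.card_coe_set_eq]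
    simp
  rw [averagedTransfer, _root_.smul_apply, _root_.sum_apply,
    ContinuousMap.smul_apply, ContinuousMap.sum_apply, Finset.sum_congr rfl fun w _ => h1 w,
    ← Fintype.sum_pow (fun i => (d i : ℝ)), div_pow, smul_eq_mul, inv_mul_eq_div]

theorem enorm_averagedTransfer_zero_one {M : Type*} [MetricSpace M] [CompactSpace M] [Nonempty M]
    {p : ℕ} (hp : 1 ≤ p) {g : Fin p → M → M} (hg : ∀ i, IsLocalHomeomorph (g i)) {d : Fin p → ℕ}
    (hd : ∀ i x, (g i ⁻¹' {x}).encard = d i) (n : ℕ) :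
    ‖averagedTransfer hg 0 n 1‖ₑ = ((∑ i, (d i : ℝ≥0∞)) / p) ^ n := by
  have h1 : averagedTransfer hg 0 n 1 =
      ContinuousMap.const M (((∑ i, (d i : ℝ)) / p) ^ n) :=
    ContinuousMap.ext (averagedTransfer_zero_one_apply hg hd n)
  have hp' : (0 : ℝ) < p := by exact_mod_cast hp
  have h2 : (0 : ℝ) ≤ (∑ i, (d i : ℝ)) / p :=
    div_nonneg (Finset.sum_nonneg fun i _ => Nat.cast_nonneg _) hp'.le
  have h3 : ‖ContinuousMap.const M (((∑ i, (d i : ℝ)) / p) ^ n)‖ = ((∑ i, (d i : ℝ)) / p) ^ n := by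
    rw [show ContinuousMap.const M (((∑ i, (d i : ℝ)) / p) ^ n) =
      (((∑ i, (d i : ℝ)) / p) ^ n) • (1 : C(M, ℝ)) by ext; simp, norm_smul, norm_one, mul_one,
      Real.norm_of_nonneg (pow_nonneg h2 n)]
  rw [h1, ← ofReal_norm, h3, ENNReal.ofReal_pow h2, ENNReal.ofReal_div_of_pos hp',
    ENNReal.ofReal_natCast, ENNReal.ofReal_sum_of_nonneg fun i _ => Nat.cast_nonneg _]
  simp

end SemigroupAction

/-! ### The common growth rate log a -/

theorem theoremA {M : Type*} [MetricSpace M] [CompactSpace M] [ConnectedSpace M] [Nontrivial M]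
    (p : ℕ) (hp : 1 ≤ p) (g : Fin p → M → M)
    (hg : ∀ i, SemigroupAction.IsRuelleExpanding (g i)) :
    0 < SemigroupAction.topEntropy g ∧
    SemigroupAction.topEntropy g < ⊤ ∧
    Filter.Tendsto
      (fun n : ℕ => ENNReal.log (SemigroupAction.averageFix g n) / (n : EReal))
      Filter.atTop (nhds (SemigroupAction.topEntropy g)) ∧
    SemigroupAction.topEntropy g =
      ENNReal.log (SemigroupAction.sequenceSpectralRadius
        (SemigroupAction.averagedTransfer (fun i => (hg i).isLocalHomeomorph) 0)) := by
  obtain ⟨c, r, ρ, h⟩ := SemigroupAction.exists_isUniformlyExpanding hp hg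
  choose d hd using fun i => SemigroupAction.exists_encard_fiber_eq (hg i).isLocalHomeomorph
  have h2d := h.two_le_degree hd
  have hp0 : (p : ℝ≥0∞) ≠ 0 := by exact_mod_cast (by omega : p ≠ 0)
  set a : ℝ≥0∞ := (∑ i, (d i : ℝ≥0∞)) / p with ha_def
  have ha1 : 1 < a := by
    have h2 : (2 : ℝ≥0∞) ≤ a := by
      rw [ENNReal.le_div_iff_mul_le (Or.inl hp0) (Or.inl (ENNReal.natCast_ne_top p))]
      have h3 : ∑ _i : Fin p, (2 : ℝ≥0∞) ≤ ∑ i, (d i : ℝ≥0∞) :=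
        Finset.sum_le_sum fun i _ => by exact_mod_cast h2d i
      simpa [mul_comm] using h3
    exact lt_of_lt_of_le (by norm_num) h2
  have ha0 : a ≠ 0 := (zero_lt_one.trans ha1).ne'
  have hatop : a ≠ ⊤ :=
    ENNReal.div_ne_top (ENNReal.sum_ne_top.2 fun i _ => ENNReal.natCast_ne_top _) hp0
  have hupper : ∀ ε > 0, ∃ C : ℝ≥0∞, C ≠ 0 ∧ C ≠ ⊤ ∧ ∀ n,
      (SemigroupAction.wordAverage p n fun w =>
        (SemigroupAction.maxSeparated g w ε : ℝ≥0∞)) ≤ C * a ^ n := by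
    intro ε hε
    obtain ⟨C, hC⟩ := h.exists_maxSeparated_le hd hε
    -- Using C + 1 makes the constant nonzero.
    refine ⟨(C + 1 : ℕ), by simp, ENNReal.natCast_ne_top _, fun n => ?_⟩
    rw [ha_def, ← SemigroupAction.wordAverage_const_mul_prod]
    refine SemigroupAction.wordAverage_mono fun w => ?_
    rw [← Nat.cast_mul, ← ENat.toENNReal_coe]
    refine ENat.toENNReal_le.2 ((hC n w).trans (Nat.cast_le.2 ?_))
    exact Nat.mul_le_mul_right _ (Nat.le_succ C)
  have hscale : ∀ ε > 0, ε ≤ c → SemigroupAction.entropyAtScale g ε = ENNReal.log a := by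
    intro ε hε hεc
    obtain ⟨C, hC0, hCtop, hC⟩ := hupper ε hε
    refine (SemigroupAction.tendsto_log_div_of_le_of_le ha0 hatop one_ne_zero ENNReal.one_ne_top
      hC0 hCtop (Eventually.of_forall fun n => ?_) (Eventually.of_forall hC)).limsup_eq
    rw [ha_def, ← SemigroupAction.wordAverage_const_mul_prod]
    refine SemigroupAction.wordAverage_mono fun w => ?_
    rw [one_mul, ← ENat.toENNReal_coe]
    exact ENat.toENNReal_le.2 (h.prod_le_maxSeparated hd hεc w)
  have hc : 0 < c := h.r_pos.trans_le h.r_le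
  -- The rate is already constant for 0 < ε ≤ c, so the limit as ε → 0⁺ is that constant.
  have htop : SemigroupAction.topEntropy g = ENNReal.log a := by
    refine tendsto_nhds_unique (SemigroupAction.tendsto_topEntropy g)
      (tendsto_const_nhds.congr' ?_)
    filter_upwards [Ioc_mem_nhdsGT hc] with ε hε
    exact (hscale ε hε.1 hε.2).symm
  refine ⟨by simpa [htop] using ha1, by simpa [htop] using lt_top_iff_ne_top.2 hatop, ?_, ?_⟩
  · rw [htop]
    obtain ⟨C, hC0, hCtop, hC⟩ := hupper (r / 2) (half_pos h.r_pos)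
    obtain ⟨N, hN⟩ := h.exists_prod_le_encard_fixedPoints hd
    -- D bounds every degree, so the N letters lost in the fixed point count cost a factor of at
    -- most D^N.
    set D : ℕ := ∑ i, d i
    have hdD : ∀ i, d i ≤ D := fun i =>
      Finset.single_le_sum (f := d) (fun _ _ => Nat.zero_le _) (Finset.mem_univ i)
    have hD : D ≠ 0 := by
      have := h2d ⟨0, hp⟩
      have := hdD ⟨0, hp⟩
      omega
    have hDN : ((D ^ N : ℕ) : ℝ≥0∞) ≠ 0 := by exact_mod_cast pow_ne_zero N hD
    refine SemigroupAction.tendsto_log_div_of_le_of_le ha0 hatop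
      (C₁ := ((D ^ N : ℕ) : ℝ≥0∞)⁻¹) (ENNReal.inv_ne_zero.2 (ENNReal.natCast_ne_top _))
      (ENNReal.inv_ne_top.2 hDN) hC0 hCtop ?_ ?_
    · filter_upwards [eventually_ge_atTop N] with n hn
      rw [ha_def, ← SemigroupAction.wordAverage_const_mul_prod]
      refine SemigroupAction.wordAverage_mono fun w => ?_
      rw [mul_comm, ← div_eq_mul_inv]
      refine ENNReal.div_le_of_le_mul' ?_
      rw [← ENat.toENNReal_coe, ← ENat.toENNReal_coe, ← ENat.toENNReal_mul]
      refine ENat.toENNReal_le.2 ?_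
      have h1 : ∏ j, d (w j) = (((List.ofFn w).take N).map d).prod *
          (((List.ofFn w).drop N).map d).prod := by
        rw [← List.prod_append, ← List.map_append, List.take_append_drop, List.map_ofFn,
          List.prod_ofFn]
        rfl
      have h2 : (((List.ofFn w).take N).map d).prod ≤ D ^ N := by
        refine (List.prod_le_pow_card _ D ?_).trans_eq ?_
        · intro x hx
          obtain ⟨i, -, rfl⟩ := List.mem_map.1 hx
          exact hdD i
        · simp [hn]
      rw [h1, Nat.cast_mul]
      exact mul_le_mul' (Nat.cast_le.2 h2) (hN (List.ofFn w) (by simpa using hn))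
    · filter_upwards [eventually_ne_atTop 0] with n hn
      refine le_trans (SemigroupAction.wordAverage_mono fun w => ?_) (hC n)
      exact ENat.toENNReal_le.2 (h.encard_fixedPoints_le_maxSeparated hn w)
  · rw [htop, SemigroupAction.sequenceSpectralRadius, EReal.log_exp]
    refine (SemigroupAction.tendsto_log_div_of_le_of_le ha0 hatop one_ne_zero ENNReal.one_ne_top
      one_ne_zero ENNReal.one_ne_top (Eventually.of_forall fun n => ?_)
      (Eventually.of_forall fun n => ?_)).limsup_eq.symm
    · rw [one_mul, SemigroupAction.enorm_averagedTransfer_zero_one hp _ hd]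
    · rw [one_mul, SemigroupAction.enorm_averagedTransfer_zero_one hp _ hd]
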